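/- Let $A$ be a finite-dimensional (associative, unital) algebra over a field. Let $\mathcal{D}(A)$ be the derived category of the category of all right $A$-modules; its objects are the $\mathbb{Z}$-indexed cochain complexes of right $A$-modules, and a module is regarded as a complex concentrated in degree $0$. Let $\mathcal{C}$ be a colocalising subcategory of $\mathcal{D}(A)$, that is, a full triangulated subcategory, closed under isomorphism, that is closed under arbitrary set-indexed products. Then the following hold. 1. (a) If $0 \to X^\bullet \to Y^\bullet \to Z^\bullet \to 0$ is a short exact sequence of complexes and two of the three objects $X^\bullet, Y^\bullet, Z^\bullet$ are in $\mathcal{C}$, then so is the third. (b) If a complex $X^\bullet$ is in $\mathcal{C}$, then so is $X^\bullet[r]$ for every $r \in \mathbb{Z}$. (c) If $X^\bullet$ and $Y^\bullet$ are quasi-isomorphic complexes (that is, related by the equivalence relation generated by the existence of a quasi-isomorphism of complexes from one to the other) and $X^\bullet$ is in $\mathcal{C}$, then so is $Y^\bullet$. (d) If $\{X_i^\bullet : i \in \mathcal{I}\}$ is a set-indexed family of complexes belonging to $\mathcal{C}$, then the (termwise) product $\prod_{i \in \mathcal{I}} X_i^\bullet$ is in $\mathcal{C}$. 2. If $X^\bullet$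 and $Y^\bullet$ are complexes whose product $X^\bullet \times Y^\bullet$ is in $\mathcal{C}$, then $X^\bullet$ and $Y^\bullet$ are in $\mathcal{C}$. 3. If $X^\bullet$ is a bounded complex and the module $X^k$ is in $\mathcal{C}$ for every $k \in \mathbb{Z}$, then $X^\bullet$ is in $\mathcal{C}$. 4. Let $\cdots \to X_3^\bullet \xrightarrow{f_3^\bullet} X_2^\bullet \xrightarrow{f_2^\bullet} X_1^\bullet \xrightarrow{f_1^\bullet} X_0^\bullet$ be an inverse system of morphisms of complexes such that, for every $k \in \mathbb{Z}$, the inverse system $\cdots \to X_2^k \to X_1^k \to X_0^k$ of $k$th terms satisfies the Mittag-Leffler condition: for each $m \geq 0$ the descending sequence of images of the composite maps $X_{m+n}^k \to X_m^k$ $(n \geq 0)$ stabilises. If each $X_m^\bullet$ is in $\mathcal{C}$, then the inverse limit $\varprojlim X_m^\bullet$, taken in the category of complexes, is in $\mathcal{C}$. 5. If $X^\bullet$ is a bounded-below complex (that is, $X^k = 0$ for all sufficiently small $k$) of modules $X^k$, each of which is in $\mathcal{C}$, then $X^\bullet$ is in $\mathcal{C}$. -/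

import Mathlib

open CategoryTheory Limits

universe w v u

/-- A full subcategory of a triangulated category, given by its class of objects `P`, is
colocalising if it is a (strictly full) triangulated subcategory that is closed under all products
indexed by sets (types in `Type u`). -/
structure IsColocalising {T : Type*} [Category* T] [HasZeroObject T] [HasShift T ℤ]
    [Preadditive T] [∀ n : ℤ, (shiftFunctor T n).Additive] [Pretriangulated T]
    (P : ObjectProperty T) : Prop where
  isClosedUnderIsomorphisms : P.IsClosedUnderIsomorphisms
  isTriangulated : P.IsTriangulated
  prod_mem : ∀ (J : Type u) (X : J → T), (∀ j, P (X j)) →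
    ∀ c : Fan X, Nonempty (IsLimit c) → P c.pt

/-- Two complexes are quasi-isomorphic if they are related by the equivalence relation generated
by the existence of a quasi-isomorphism from one to the other. -/
def QuasiIsomorphic {M : Type*} [Category* M] [Abelian M] (X Y : CochainComplex M ℤ) : Prop :=
  Relation.EqvGen (fun K L : CochainComplex M ℤ => ∃ f : K ⟶ L, QuasiIso f) X Y

/-- An inverse system `⋯ ⟶ X₂ ⟶ X₁ ⟶ X₀` of complexes of modules satisfies the Mittag-Leffler
condition in every degree: for each `k` and `m`, the descending sequence of the images of
`X_{m+n}^k ⟶ X_m^k` stabilises. -/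
def IsTermwiseMittagLeffler {R : Type u} [Ring R]
    (F : ℕᵒᵖ ⥤ CochainComplex (ModuleCat.{u} R) ℤ) : Prop :=
  ∀ k : ℤ, (F ⋙ HomologicalComplex.eval (ModuleCat.{u} R) (ComplexShape.up ℤ) k ⋙
    forget (ModuleCat.{u} R)).IsMittagLeffler

/-!
Let `C` be a colocalising subcategory of the derived category of a module category.

The only property of `C` that does not come from distinguished triangles is closure under products,
and it concerns products formed in the derived category. The bridge to complexes is
`DerivedCategory.isLimitFanQPi`: the localization functor `Q` preserves products. Products of
quasi-isomorphisms are quasi-isomorphisms (`HomologicalComplex.quasiIso_piMap`), because a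
quasi-isomorphism is recognised by lifting classes represented by morphisms out of projective
objects, a condition that can be checked in each factor. Given this, a family of left fractions
with values in the factors combines into a left fraction with values in the product, and a family
of null-homotopies combines into a null-homotopy, so that maps into `Q.obj (∏ᶜ X)` exist and are
unique.

The rest consists in finding short exact sequences.

* If `Z = (X ⨯ Y)^ℕ`, there is a split exact sequence `0 ⟶ X ⟶ Z ⟶ Z ⟶ 0`
  (`exists_splitting_pi_prod`), so that `C` is closed under direct factors.
* A complex that starts in degree `a` maps onto its term of degree `a`, placed in that degree, with
  a shorter kernel; this gives bounded complexes (`DerivedCategory.prop_Q_of_bounded`).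
* The limit of an inverse system is the kernel of the endomorphism `(xₙ)ₙ ↦ (xₙ - φ xₙ₊₁)ₙ` of the
  product of its terms. Under the Mittag-Leffler condition, this endomorphism is an epimorphism
  (`CategoryTheory.Functor.IsMittagLeffler.exists_sub_map_eq`), so that the limit lies in `C` when
  the terms do.
* A bounded-below complex is the limit of its stupid truncations, which are bounded and whose
  transition maps are surjective.
-/

/-! ### Products of complexes and the derived category -/

namespace HomologicalComplex

/-- The fan of the `k`-th terms of a product of complexes is a limit fan. -/
noncomputable def isLimitFanPiX {M ι : Type*} [Category* M] [HasZeroMorphisms M]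
    {c : ComplexShape ι} {J : Type*} [HasProductsOfShape J M]
    (X : J → HomologicalComplex M c) (k : ι) :
    IsLimit (Fan.mk ((∏ᶜ X).X k) fun j => (Pi.π X j).f k) :=
  isLimitOfHasProductOfPreservesLimit (eval M c k) X

lemma exists_lift_piX {M ι : Type*} [Category* M] [HasZeroMorphisms M]
    {c : ComplexShape ι} {J : Type*} [HasProductsOfShape J M]
    (X : J → HomologicalComplex M c) (k : ι) {T : M} (x : ∀ j, T ⟶ (X j).X k) :
    ∃ y : T ⟶ (∏ᶜ X).X k, ∀ j, y ≫ (Pi.π X j).f k = x j :=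
  ⟨Fan.IsLimit.lift (isLimitFanPiX X k) x, fun j => Fan.IsLimit.fac (isLimitFanPiX X k) x j⟩

lemma piX_hom_ext {M ι : Type*} [Category* M] [HasZeroMorphisms M]
    {c : ComplexShape ι} {J : Type*} [HasProductsOfShape J M]
    (X : J → HomologicalComplex M c) (k : ι) {T : M} {x y : T ⟶ (∏ᶜ X).X k}
    (h : ∀ j, x ≫ (Pi.π X j).f k = y ≫ (Pi.π X j).f k) : x = y :=
  Fan.IsLimit.hom_ext (isLimitFanPiX X k) x y h

variable {M ι : Type*} [Category* M] [Abelian M] {c : ComplexShape ι}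

/-- With enough projectives, a morphism of complexes is an isomorphism on homology as soon as
classes represented by morphisms out of a projective object lift along it, uniquely. Unlike the
version up to refinements, this criterion involves no auxiliary epimorphism, so that it can be
checked factor by factor in a product. -/
lemma quasiIso_iff_projective [EnoughProjectives M] {K L : HomologicalComplex M c} (φ : K ⟶ L) :
    QuasiIso φ ↔ ∀ (j : ι) (P : M) [Projective P],
      (∀ (x : P ⟶ K.X j) (_ : x ≫ K.d j (c.next j) = 0) (y : P ⟶ L.X (c.prev j))
        (_ : x ≫ φ.f j = y ≫ L.d (c.prev j) j), ∃ x' : P ⟶ K.X (c.prev j),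
          x = x' ≫ K.d (c.prev j) j) ∧
      (∀ (y : P ⟶ L.X j) (_ : y ≫ L.d j (c.next j) = 0),
        ∃ (x : P ⟶ K.X j) (_ : x ≫ K.d j (c.next j) = 0) (y' : P ⟶ L.X (c.prev j)),
          y = x ≫ φ.f j + y' ≫ L.d (c.prev j) j) := by
  rw [quasiIso_iff]
  refine forall_congr' fun j => ?_
  rw [quasiIsoAt_iff_isIso_homologyMap, isIso_iff_mono_and_epi,
    mono_homologyMap_iff_up_to_refinements φ _ j _ rfl rfl,
    epi_homologyMap_iff_up_to_refinements φ _ j _ rfl rfl]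
  constructor
  · rintro ⟨h₁, h₂⟩ P _
    refine ⟨fun x hx y hy => ?_, fun y hy => ?_⟩
    · obtain ⟨A, π, _, x', h⟩ := h₁ x hx y hy
      exact ⟨Projective.factorThru (𝟙 P) π ≫ x', by
        rw [Category.assoc, ← h, Projective.factorThru_comp_assoc, Category.id_comp]⟩
    · obtain ⟨A, π, _, x, hx, y', h⟩ := h₂ y hy
      exact ⟨Projective.factorThru (𝟙 P) π ≫ x, by rw [Category.assoc, hx, comp_zero],
        Projective.factorThru (𝟙 P) π ≫ y', by
          rw [Category.assoc, Category.assoc, ← Preadditive.comp_add, ← h,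
            Projective.factorThru_comp_assoc, Category.id_comp]⟩
  · intro h
    refine ⟨fun A x hx y hy => ?_, fun A y hy => ?_⟩
    · obtain ⟨x', h'⟩ := (h (Projective.over A)).1 (Projective.π A ≫ x)
        (by rw [Category.assoc, hx, comp_zero]) (Projective.π A ≫ y)
        (by rw [Category.assoc, hy, Category.assoc])
      exact ⟨_, Projective.π A, inferInstance, x', h'⟩
    · obtain ⟨x, hx, y', h'⟩ := (h (Projective.over A)).2 (Projective.π A ≫ y)
        (by rw [Category.assoc, hy, comp_zero])
      exact ⟨_, Projective.π A, inferInstance, x, hx, y', h'⟩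

lemma quasiIso_piMap [EnoughProjectives M] {J : Type*} [HasProductsOfShape J M]
    {X Y : J → HomologicalComplex M c} (f : ∀ j, X j ⟶ Y j) (hf : ∀ j, QuasiIso (f j)) :
    QuasiIso (Limits.Pi.map f) := by
  have hπ (i : J) (k : ι) :
      (Limits.Pi.map f).f k ≫ (Pi.π Y i).f k = (Pi.π X i).f k ≫ (f i).f k := by
    rw [← comp_f, ← comp_f, Pi.map_π]
  simp only [quasiIso_iff_projective] at hf ⊢
  intro k P _
  refine ⟨fun x hx y hy => ?_, fun y hy => ?_⟩
  · have h (i : J) := (hf i k P).1 (x ≫ (Pi.π X i).f k)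
      (by rw [Category.assoc, Hom.comm, reassoc_of% hx, zero_comp]) (y ≫ (Pi.π Y i).f _)
      (by rw [Category.assoc, ← hπ, reassoc_of% hy, Category.assoc, Hom.comm])
    choose x' hx' using h
    obtain ⟨z, hz⟩ := exists_lift_piX X (c.prev k) x'
    refine ⟨z, piX_hom_ext X k fun i => ?_⟩
    rw [hx', Category.assoc, ← Hom.comm, reassoc_of% (hz i)]
  · have h (i : J) := (hf i k P).2 (y ≫ (Pi.π Y i).f k)
      (by rw [Category.assoc, Hom.comm, reassoc_of% hy, zero_comp])
    choose x hx y' hy' using h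
    obtain ⟨z, hz⟩ := exists_lift_piX X k x
    obtain ⟨z', hz'⟩ := exists_lift_piX Y (c.prev k) y'
    refine ⟨z, piX_hom_ext X _ fun i => ?_, z', piX_hom_ext Y k fun i => ?_⟩
    · rw [Category.assoc, ← Hom.comm, reassoc_of% (hz i), hx, zero_comp]
    · rw [hy', Preadditive.add_comp, Category.assoc, Category.assoc, hπ, ← Hom.comm,
        reassoc_of% (hz i), reassoc_of% (hz' i)]

/-- A family of null-homotopies of the components of a morphism into a product is a null-homotopy
of that morphism. -/
lemma nonempty_homotopy_zero_of_pi {J : Type*} [HasProductsOfShape J M]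
    {K : HomologicalComplex M c} {X : J → HomologicalComplex M c} (f : K ⟶ ∏ᶜ X)
    (h : ∀ j, Nonempty (Homotopy (f ≫ Pi.π X j) 0)) : Nonempty (Homotopy f 0) := by
  have h (j : J) := Classical.choice (h j)
  have hl (k l : ι) := exists_lift_piX X l fun j => (h j).hom k l
  choose s hs using hl
  refine ⟨⟨s, fun k l hkl => piX_hom_ext X l fun j => ?_, fun k => piX_hom_ext X k fun j => ?_⟩⟩
  · rw [hs, (h j).zero k l hkl, zero_comp]
  · have := (h j).comm k
    rw [comp_f] at this
    rw [this]
    simp [dNext, prevD, Preadditive.add_comp, Category.assoc, hs, ← Hom.comm, reassoc_of% hs]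

end HomologicalComplex

namespace DerivedCategory

variable {M : Type u} [Category.{v} M] [Abelian M] [HasDerivedCategory.{w} M]

/-- A morphism of complexes that vanishes in the derived category becomes null-homotopic after
composition with a quasi-isomorphism, by the calculus of fractions in the homotopy category. -/
lemma exists_homotopy_of_Q_map_eq_zero {X Y : CochainComplex M ℤ} (f : X ⟶ Y)
    (hf : Q.map f = 0) :
    ∃ (Z : CochainComplex M ℤ) (s : Y ⟶ Z), QuasiIso s ∧ Nonempty (Homotopy (f ≫ s) 0) := by
  have hf' : Qh.map ((HomotopyCategory.quotient M _).map f) =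
      Qh.map ((HomotopyCategory.quotient M _).map (0 : X ⟶ Y)) := by
    have := quotientCompQhIso_hom_naturality f
    rw [hf, comp_zero] at this
    rw [← cancel_mono ((quotientCompQhIso M).hom.app Y), this]
    simp
  rw [MorphismProperty.map_eq_iff_postcomp Qh
    (HomotopyCategory.quasiIso M (ComplexShape.up ℤ))] at hf'
  obtain ⟨Z, s, hs, h⟩ := hf'
  obtain ⟨Z, rfl⟩ := HomotopyCategory.quotient_obj_surjective Z
  obtain ⟨s, rfl⟩ := (HomotopyCategory.quotient _ _).map_surjective s
  refine ⟨Z, s, ?_, ⟨HomotopyCategory.homotopyOfEq _ _ ?_⟩⟩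
  · rwa [HomotopyCategory.quotient_map_mem_quasiIso_iff] at hs
  · rw [Functor.map_comp, h]
    simp

/-- The localization functor from complexes to the derived category preserves those products
that exist in an abelian category with enough projectives. -/
noncomputable def isLimitFanQPi [EnoughProjectives M] {J : Type*} [HasProductsOfShape J M]
    (X : J → CochainComplex M ℤ) :
    IsLimit (Fan.mk (Q.obj (∏ᶜ X)) fun j => Q.map (Pi.π X j)) := by
  -- a morphism into the product vanishes as soon as its components do
  have hzero {T : CochainComplex M ℤ} (f : Q.obj T ⟶ Q.obj (∏ᶜ X))
      (hf : ∀ j, f ≫ Q.map (Pi.π X j) = 0) : f = 0 := by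
    obtain ⟨T', t, _, g, rfl⟩ := right_fac f
    have hg (j : J) : Q.map (g ≫ Pi.π X j) = 0 := by
      have := hf j
      rwa [Category.assoc, IsIso.inv_comp_eq, comp_zero, ← Functor.map_comp] at this
    choose Y s hs hsg using fun j => exists_homotopy_of_Q_map_eq_zero _ (hg j)
    have : QuasiIso (Limits.Pi.map s) := HomologicalComplex.quasiIso_piMap s hs
    obtain ⟨h⟩ := HomologicalComplex.nonempty_homotopy_zero_of_pi (g ≫ Limits.Pi.map s) fun j => by
      rw [Category.assoc, Pi.map_π, ← Category.assoc]
      exact hsg j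
    have h' := Q_map_eq_of_homotopy _ h
    rw [Functor.map_comp, Functor.map_zero] at h'
    rw [← cancel_mono (Q.map (Limits.Pi.map s)), Category.assoc, h', comp_zero, zero_comp]
  -- left fractions with values in the factors combine into one with values in the product
  have hex {T : CochainComplex M ℤ} (f : ∀ j, Q.obj T ⟶ Q.obj (X j)) :
      ∃ g : Q.obj T ⟶ Q.obj (∏ᶜ X), ∀ j, g ≫ Q.map (Pi.π X j) = f j := by
    choose Y g s hs hf using fun j => left_fac (f j)
    have hs' (j : J) : QuasiIso (s j) := by rw [← isIso_Q_map_iff_quasiIso]; exact hs j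
    have : QuasiIso (Limits.Pi.map s) := HomologicalComplex.quasiIso_piMap s hs'
    refine ⟨Q.map (Pi.lift g) ≫ inv (Q.map (Limits.Pi.map s)), fun j => ?_⟩
    have h : Q.map (Limits.Pi.map s) ≫ Q.map (Pi.π Y j) = Q.map (Pi.π X j) ≫ Q.map (s j) := by
      rw [← Functor.map_comp, ← Functor.map_comp, Pi.map_π]
    rw [hf, ← cancel_mono (Q.map (s j)), Category.assoc, Category.assoc, ← h,
      IsIso.inv_hom_id_assoc, ← Functor.map_comp, Pi.lift_π, Category.assoc, IsIso.inv_hom_id,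
      Category.comp_id]
  have hex' (T : DerivedCategory M) (f : ∀ j, T ⟶ Q.obj (X j)) :
      ∃ g : T ⟶ Q.obj (∏ᶜ X), ∀ j, g ≫ Q.map (Pi.π X j) = f j := by
    obtain ⟨g, hg⟩ := hex fun j => (Q.objObjPreimageIso T).hom ≫ f j
    exact ⟨(Q.objObjPreimageIso T).inv ≫ g, fun j => by
      rw [Category.assoc, hg, Iso.inv_hom_id_assoc]⟩
  have huniq (T : DerivedCategory M) (f g : T ⟶ Q.obj (∏ᶜ X))
      (h : ∀ j, f ≫ Q.map (Pi.π X j) = g ≫ Q.map (Pi.π X j)) : f = g := by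
    rw [← sub_eq_zero, ← cancel_epi (Q.objObjPreimageIso T).hom, comp_zero]
    exact hzero _ fun j => by simp [h]
  refine Fan.IsLimit.mk _ (fun f => (hex' _ f.proj).choose)
    (fun f j => (hex' _ f.proj).choose_spec j) fun f g hg => huniq _ _ _ fun j => ?_
  exact (hg j).trans ((hex' _ f.proj).choose_spec j).symm

end DerivedCategory

/-! ### Closure under extensions, and bounded complexes -/

namespace DerivedCategory

variable {M : Type u} [Category.{v} M] [Abelian M] [HasDerivedCategory.{w} M]

section Triangulated

variable (P : ObjectProperty (DerivedCategory M)) [P.IsClosedUnderIsomorphisms] [P.IsTriangulated]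

variable {P} in
omit [P.IsTriangulated] in
lemma prop_Q_iff_of_quasiIsomorphic {X Y : CochainComplex M ℤ} (h : QuasiIsomorphic X Y) :
    P (Q.obj X) ↔ P (Q.obj Y) := by
  induction h with
  | rel X Y h => obtain ⟨f, _⟩ := h; exact P.prop_iff_of_iso (asIso (Q.map f))
  | refl X => rfl
  | symm X Y _ h => exact h.symm
  | trans X Y Z _ _ h h' => exact h.trans h'

variable {P} in
lemma prop_Q_shift {X : CochainComplex M ℤ} (h : P (Q.obj X)) (r : ℤ) : P (Q.obj (X⟦r⟧)) :=
  P.prop_of_iso ((Q.commShiftIso r).app X).symm (P.le_shift r _ h)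

variable {P} in
lemma prop_singleFunctor {A : M} (h : P ((singleFunctor M 0).obj A)) (n : ℤ) :
    P ((singleFunctor M n).obj A) :=
  P.prop_of_iso (((singleFunctors M).shiftIso (-n) n 0 (by lia)).app A) (P.le_shift (-n) _ h)

lemma prop_X₃_of_shortExact {S : ShortComplex (CochainComplex M ℤ)} (hS : S.ShortExact)
    (h₁ : P (Q.obj S.X₁)) (h₂ : P (Q.obj S.X₂)) : P (Q.obj S.X₃) :=
  P.ext_of_isTriangulatedClosed₃ _ (triangleOfSES_distinguished hS) h₁ h₂

lemma prop_X₂_of_shortExact {S : ShortComplex (CochainComplex M ℤ)} (hS : S.ShortExact)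
    (h₁ : P (Q.obj S.X₁)) (h₃ : P (Q.obj S.X₃)) : P (Q.obj S.X₂) :=
  P.ext_of_isTriangulatedClosed₂ _ (triangleOfSES_distinguished hS) h₁ h₃

lemma prop_X₁_of_shortExact {S : ShortComplex (CochainComplex M ℤ)} (hS : S.ShortExact)
    (h₂ : P (Q.obj S.X₂)) (h₃ : P (Q.obj S.X₃)) : P (Q.obj S.X₁) :=
  P.ext_of_isTriangulatedClosed₁ _ (triangleOfSES_distinguished hS) h₂ h₃

lemma prop_Q_of_isZero {X : CochainComplex M ℤ} (h : ∀ k, IsZero (X.X k)) : P (Q.obj X) := by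
  have hX : IsZero X := (IsZero.iff_id_eq_zero _).2 <| by
    ext k
    exact (h k).eq_of_src _ _
  exact P.prop_of_isZero (Q.map_isZero hX)

/-- Induction on the length: a complex starting in degree `a` maps onto its term of degree `a`,
placed in that degree, and the kernel of this map has the same terms in the other degrees. -/
lemma prop_Q_of_bounded (n : ℕ) (a : ℤ) (X : CochainComplex M ℤ)
    (hGE : ∀ k < a, IsZero (X.X k)) (hLE : ∀ k, a + n ≤ k → IsZero (X.X k))
    (h : ∀ k, P ((singleFunctor M 0).obj (X.X k))) : P (Q.obj X) := by
  induction n generalizing a X with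
  | zero =>
    refine prop_Q_of_isZero P fun k => ?_
    by_cases hk : k < a
    · exact hGE k hk
    · exact hLE k (by push_cast; lia)
  | succ n ih =>
    let p : X ⟶ (HomologicalComplex.single M (ComplexShape.up ℤ) a).obj (X.X a) :=
      HomologicalComplex.mkHomToSingle (𝟙 _) fun i hi =>
        (hGE i (by simp at hi; lia)).eq_of_src _ _
    have hz (k : ℤ) (hk : k ≠ a) :
        IsZero (((HomologicalComplex.single M (ComplexShape.up ℤ) a).obj (X.X a)).X k) :=
      HomologicalComplex.isZero_single_obj_X _ _ _ _ hk
    have hp : IsIso (p.f a) := by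
      rw [HomologicalComplex.mkHomToSingle_f]
      infer_instance
    have : Epi p := by
      refine HomologicalComplex.epi_of_epi_f _ fun k => ?_
      by_cases hk : k = a
      · subst hk
        infer_instance
      · exact ⟨fun _ _ _ => (hz k hk).eq_of_src _ _⟩
    let S : ShortComplex (CochainComplex M ℤ) := .mk (kernel.ι p) p (kernel.condition p)
    have hS : S.ShortExact :=
      { exact := S.exact_of_f_is_kernel (kernelIsKernel p)
        mono_f := inferInstanceAs (Mono (kernel.ι p))
        epi_g := this }
    have hSk (k : ℤ) := hS.map_of_exact (HomologicalComplex.eval M (ComplexShape.up ℤ) k)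
    have ha : IsZero ((kernel p).X a) := (hSk a).isIso_g_iff.1 hp
    have hiso (k : ℤ) (hk : k ≠ a) : IsIso ((kernel.ι p).f k) :=
      (hSk k).isIso_f_iff.2 (hz k hk)
    refine prop_X₂_of_shortExact P hS (ih (a + 1) (kernel p) (fun k hk => ?_) (fun k hk => ?_)
      fun k => ?_) (prop_singleFunctor (h a) a)
    · by_cases hka : k = a
      · rwa [hka]
      · have := hiso k hka
        exact (hGE k (by lia)).of_iso (asIso ((kernel.ι p).f k))
    · have := hiso k (by lia)
      exact (hLE k (by push_cast; lia)).of_iso (asIso ((kernel.ι p).f k))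
    · by_cases hka : k = a
      · subst hka
        exact P.prop_of_isZero (Functor.map_isZero _ ha)
      · have := hiso k hka
        exact P.prop_of_iso ((singleFunctor M 0).mapIso (asIso ((kernel.ι p).f k))).symm (h k)

end Triangulated

end DerivedCategory

/-! ### Closure under products and direct factors -/

/-- A variant of Eilenberg's swindle: if `Z = (X ⨯ Y)^ℕ`, then forgetting the first factor `X` is
a split epimorphism `Z ⟶ Z` with kernel `X`. -/
lemma exists_splitting_pi_prod {D : Type*} [Category* D] [Preadditive D] [HasBinaryProducts D]
    [HasProductsOfShape ℕ D] (X Y : D) :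
    ∃ (i : X ⟶ ∏ᶜ fun _ : ℕ => X ⨯ Y) (p : (∏ᶜ fun _ : ℕ => X ⨯ Y) ⟶ ∏ᶜ fun _ : ℕ => X ⨯ Y)
      (w : i ≫ p = 0), Nonempty (ShortComplex.mk i p w).Splitting := by
  let Z := ∏ᶜ fun _ : ℕ => X ⨯ Y
  let π (n : ℕ) : Z ⟶ X ⨯ Y := Pi.π (fun _ : ℕ => X ⨯ Y) n
  let i : X ⟶ Z := Pi.lift fun n => n.casesOn (prod.lift (𝟙 X) 0) fun _ => 0
  let p : Z ⟶ Z := Pi.lift fun n => prod.lift (π (n + 1) ≫ prod.fst) (π n ≫ prod.snd)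
  let s : Z ⟶ Z := Pi.lift fun n => n.casesOn (prod.lift 0 (π 0 ≫ prod.snd))
    fun n => prod.lift (π n ≫ prod.fst) (π (n + 1) ≫ prod.snd)
  have hi₀ : i ≫ π 0 = prod.lift (𝟙 X) 0 := Pi.lift_π _ _
  have hi (n : ℕ) : i ≫ π (n + 1) = 0 := Pi.lift_π _ _
  have hp (n : ℕ) : p ≫ π n = prod.lift (π (n + 1) ≫ prod.fst) (π n ≫ prod.snd) := Pi.lift_π _ _
  have hs₀ : s ≫ π 0 = prod.lift 0 (π 0 ≫ prod.snd) := Pi.lift_π _ _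
  have hs (n : ℕ) : s ≫ π (n + 1) = prod.lift (π n ≫ prod.fst) (π (n + 1) ≫ prod.snd) :=
    Pi.lift_π _ _
  have hext {T : D} {f g : T ⟶ Z} (h : ∀ n, f ≫ π n = g ≫ π n) : f = g :=
    Pi.hom_ext _ _ h
  have w : i ≫ p = 0 := hext fun n => by
    rw [Category.assoc, hp, zero_comp]
    ext : 1
    · simp [prod.lift_fst, reassoc_of% hi]
    · cases n <;> simp [prod.lift_snd, reassoc_of% hi₀, reassoc_of% hi]
  exact ⟨i, p, w, ⟨{
      r := π 0 ≫ prod.fst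
      -- reinsert a zero as the first `X`-component
      s := s
      f_r := show i ≫ π 0 ≫ prod.fst = 𝟙 X by rw [reassoc_of% hi₀, prod.lift_fst]
      s_g := show s ≫ p = 𝟙 Z from hext fun n => by
        rw [Category.assoc, hp]
        ext : 1
        · simp [prod.lift_fst, reassoc_of% hs]
        · cases n <;> simp [prod.lift_fst, prod.lift_snd, reassoc_of% hs₀, reassoc_of% hs]
      id := show (π 0 ≫ prod.fst) ≫ i + p ≫ s = 𝟙 Z from hext fun n => by
        rw [Preadditive.add_comp]
        cases n with
        | zero =>
          simp only [Category.assoc, hi₀, hs₀]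
          ext : 1 <;> simp [prod.lift_fst, prod.lift_snd, reassoc_of% hp]
        | succ n =>
          simp only [Category.assoc, hi, hs]
          ext : 1 <;> simp [prod.lift_fst, prod.lift_snd, reassoc_of% hp] }⟩⟩

namespace IsColocalising

open DerivedCategory

universe t

variable {M : Type u} [Category.{v} M] [Abelian M] [HasDerivedCategory.{w} M]
  [EnoughProjectives M] {P : ObjectProperty (DerivedCategory M)}

/-- Closure under products in the derived category, applied to a termwise product of
complexes. -/
lemma prop_Q_pi (hP : IsColocalising.{t} P) {J : Type t} [HasProductsOfShape J M]
    (X : J → CochainComplex M ℤ) (h : ∀ j, P (Q.obj (X j))) : P (Q.obj (∏ᶜ X)) :=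
  hP.prod_mem J _ h _ ⟨isLimitFanQPi X⟩

/-- The set `ℕ` has to be lifted to the universe in which the products are indexed. -/
lemma prop_Q_pi_nat (hP : IsColocalising.{t} P) [HasCountableProducts M]
    (X : ℕ → CochainComplex M ℤ) (h : ∀ n, P (Q.obj (X n))) : P (Q.obj (∏ᶜ X)) := by
  have := hP.isClosedUnderIsomorphisms
  exact P.prop_of_iso (Q.mapIso (Pi.reindex Equiv.ulift.{t} X))
    (hP.prop_Q_pi (X ∘ Equiv.ulift) fun n => h n.down)

lemma prop_Q_fst (hP : IsColocalising.{t} P) [HasCountableProducts M]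
    {X Y : CochainComplex M ℤ} (h : P (Q.obj (X ⨯ Y))) : P (Q.obj X) := by
  have := hP.isClosedUnderIsomorphisms
  have := hP.isTriangulated
  have hZ := hP.prop_Q_pi_nat (fun _ => X ⨯ Y) fun _ => h
  obtain ⟨i, p, w, ⟨e⟩⟩ := exists_splitting_pi_prod X Y
  exact prop_X₁_of_shortExact P e.shortExact hZ hZ

lemma prop_Q_snd (hP : IsColocalising.{t} P) [HasCountableProducts M]
    {X Y : CochainComplex M ℤ} (h : P (Q.obj (X ⨯ Y))) : P (Q.obj Y) := by
  have := hP.isClosedUnderIsomorphisms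
  exact hP.prop_Q_fst (P.prop_of_iso (Q.mapIso (prod.braiding X Y)) h)

end IsColocalising

/-! ### Limits of Mittag-Leffler systems -/

section

open Opposite

/-- The vanishing of the first derived limit of a Mittag-Leffler system. Modulo the eventual
images `E m` the equation `x m - φ (x (m + 1)) = y m` is solved by the sum of the images of the
`y j`, which is finite because `y j` has its image in `E m` for large `j`; the error then lies in
the system of the `E m`, where the transition maps are surjective and one can solve by recursion. -/
lemma CategoryTheory.Functor.IsMittagLeffler.exists_sub_map_eq {R : Type u} [Ring R]
    {F : ℕᵒᵖ ⥤ ModuleCat.{v} R} (hF : (F ⋙ forget (ModuleCat.{v} R)).IsMittagLeffler)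
    (y : ∀ n, F.obj (op n)) :
    ∃ x : ∀ n, F.obj (op n), ∀ n, x n - F.map (homOfLE (n.le_add_right 1)).op (x (n + 1)) = y n := by
  let φ {m n : ℕ} (h : m ≤ n) : F.obj (op n) →ₗ[R] F.obj (op m) := (F.map (homOfLE h).op).hom
  have hφ {m n p : ℕ} (h : m ≤ n) (h' : n ≤ p) (a : F.obj (op p)) :
      φ h (φ h' a) = φ (h.trans h') a := by
    change (F.map (homOfLE h).op) ((F.map (homOfLE h').op) a) = F.map (homOfLE _).op a
    rw [← ConcreteCategory.comp_apply, ← F.map_comp]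
    rfl
  have hφ_self (m : ℕ) (a : F.obj (op m)) : φ le_rfl a = a := by
    change F.map (𝟙 _) a = a
    rw [F.map_id]
    rfl
  obtain ⟨N, hN, hE⟩ : ∃ (N : ℕ → ℕ) (hN : ∀ m, m ≤ N m),
      ∀ m, (F ⋙ forget (ModuleCat.{v} R)).eventualRange (op m) = Set.range (φ (hN m)) := by
    choose i f hi using (Functor.isMittagLeffler_iff_eventualRange _).1 hF
    exact ⟨fun m => (i (op m)).unop, fun m => leOfHom (f (op m)).unop, fun m => hi (op m)⟩
  let E (m : ℕ) : Submodule R (F.obj (op m)) := LinearMap.range (φ (hN m))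
  have hEmem {m j : ℕ} (hj : N m ≤ j) (h : m ≤ j) (a : F.obj (op j)) : φ h a ∈ E m :=
    ⟨φ hj a, hφ _ _ _⟩
  -- the eventual images form an inverse system with surjective transition maps
  have hEmap (m : ℕ) (b : F.obj (op m)) : b ∈ E m ↔ ∃ a ∈ E (m + 1), φ (m.le_add_right 1) a = b := by
    have := Functor.IsMittagLeffler.eq_image_eventualRange _ hF (homOfLE (m.le_add_right 1)).op
    rw [hE, hE] at this
    exact Set.ext_iff.1 this b
  -- the image of `y j` in the `m`-th module, with the junk value `0` for `j < m`
  let g (m j : ℕ) : F.obj (op m) := if h : m ≤ j then φ h (y j) else 0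
  have hg {m j : ℕ} (h : m + 1 ≤ j) : φ (m.le_add_right 1) (g (m + 1) j) = g m j := by
    simp only [g, dif_pos h, dif_pos ((m.le_add_right 1).trans h), hφ]
  have hg_self (m : ℕ) : g m m = y m := by simp only [g, dif_pos le_rfl, hφ_self]
  have hgE {m j : ℕ} (h : N m ≤ j) : g m j ∈ E m := by
    simp only [g, dif_pos ((hN m).trans h)]
    exact hEmem h _ _
  let x₀ (m : ℕ) : F.obj (op m) := ∑ j ∈ Finset.Ico m (N m), g m j
  have hx₀ (m n : ℕ) (hn : N m ≤ n) : ∑ j ∈ Finset.Ico m n, g m j - x₀ m ∈ E m := by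
    rw [← Finset.sum_Ico_consecutive _ (hN m) hn, add_sub_cancel_left]
    exact Submodule.sum_mem _ fun j hj => hgE (Finset.mem_Ico.1 hj).1
  have herr (m : ℕ) : x₀ m - φ (m.le_add_right 1) (x₀ (m + 1)) - y m ∈ E m := by
    let n := max (N m) (N (m + 1))
    have h₁ := hx₀ m n (le_max_left _ _)
    have h₂ := (hEmap m _).2 ⟨_, hx₀ (m + 1) n (le_max_right _ _), rfl⟩
    have h₃ : ∑ j ∈ Finset.Ico m n, g m j =
        y m + φ (m.le_add_right 1) (∑ j ∈ Finset.Ico (m + 1) n, g (m + 1) j) := by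
      rw [Finset.sum_eq_sum_Ico_succ_bot
        (m.lt_succ_self.trans_le ((hN (m + 1)).trans (le_max_right _ _))), hg_self,
        _root_.map_sum]
      congr 1
      exact Finset.sum_congr rfl fun j hj => (hg (Finset.mem_Ico.1 hj).1).symm
    convert (E m).sub_mem h₂ h₁ using 1
    rw [h₃, _root_.map_sub]
    abel
  -- solve for the error inside the eventual images
  have hstep (m : ℕ) (b : E m) : ∃ a : E (m + 1),
      φ (m.le_add_right 1) a =
        (b : F.obj (op m)) - (y m - (x₀ m - φ (m.le_add_right 1) (x₀ (m + 1)))) := by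
    obtain ⟨a, ha, h⟩ := (hEmap m _).1 ((E m).add_mem b.2 (herr m))
    refine ⟨⟨a, ha⟩, h.trans ?_⟩
    abel
  choose step hstep using hstep
  let e (m : ℕ) : E m := Nat.rec (motive := fun m => E m) 0 step m
  have he (m : ℕ) : φ (m.le_add_right 1) (e (m + 1)) =
      (e m : F.obj (op m)) - (y m - (x₀ m - φ (m.le_add_right 1) (x₀ (m + 1)))) := hstep m (e m)
  refine ⟨fun m => x₀ m + e m, fun m => ?_⟩
  change x₀ m + e m - φ (m.le_add_right 1) (x₀ (m + 1) + e (m + 1)) = y m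
  rw [_root_.map_add, he]
  abel

namespace CategoryTheory.Limits

variable {D : Type*} [Category* D] [Preadditive D] [HasProductsOfShape ℕ D] (F : ℕᵒᵖ ⥤ D)

/-- The endomorphism `(xₙ)ₙ ↦ (xₙ - φ xₙ₊₁)ₙ` of the product of the terms of an inverse
system. -/
noncomputable def oneSubShift :
    (∏ᶜ fun n => F.obj (Opposite.op n)) ⟶ ∏ᶜ fun n => F.obj (Opposite.op n) :=
  𝟙 _ - Pi.lift fun n =>
    Pi.π (fun n => F.obj (Opposite.op n)) (n + 1) ≫ F.map (homOfLE (n.le_add_right 1)).op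

lemma oneSubShift_π (n : ℕ) :
    oneSubShift F ≫ Pi.π _ n =
      Pi.π (fun n => F.obj (Opposite.op n)) n -
        Pi.π _ (n + 1) ≫ F.map (homOfLE (n.le_add_right 1)).op := by
  simp [oneSubShift, Preadditive.sub_comp]

variable {F}

lemma Cone.lift_comp_oneSubShift (c : Cone F) :
    (Pi.lift fun n => c.π.app (Opposite.op n)) ≫ oneSubShift F = 0 := by
  ext n
  have := c.w (homOfLE (n.le_add_right 1)).op
  simp [oneSubShift_π, Preadditive.comp_sub, this]

/-- A limit of an inverse system is the kernel of `oneSubShift`. -/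
noncomputable def IsLimit.isLimitKernelFork {c : Cone F} (hc : IsLimit c) :
    IsLimit (KernelFork.ofι _ c.lift_comp_oneSubShift) :=
  have h {T : D} (t : T ⟶ ∏ᶜ fun n => F.obj (Opposite.op n)) (ht : t ≫ oneSubShift F = 0) (n : ℕ) :
      t ≫ Pi.π _ n = (t ≫ Pi.π _ (n + 1)) ≫ F.map (homOfLE (n.le_add_right 1)).op := by
    have := ht =≫ Pi.π _ n
    rwa [Category.assoc, oneSubShift_π, Preadditive.comp_sub, zero_comp, sub_eq_zero,
      ← Category.assoc] at this
  KernelFork.IsLimit.ofι _ _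
    (fun {T} t ht => hc.lift
      { pt := T
        π := NatTrans.ofOpSequence (fun n => t ≫ Pi.π _ n) fun n => by
          simpa using h t ht n })
    (fun t ht => Pi.hom_ext _ _ fun n => by
      rw [Category.assoc, Pi.lift_π, hc.fac]
      rfl)
    (fun t ht m hm => hc.hom_ext fun ⟨n⟩ => by
      rw [hc.fac]
      subst hm
      simp)

end CategoryTheory.Limits

namespace IsTermwiseMittagLeffler

variable {R : Type u} [Ring R] {F : ℕᵒᵖ ⥤ CochainComplex (ModuleCat.{u} R) ℤ}

lemma epi_oneSubShift (hF : IsTermwiseMittagLeffler F) : Epi (oneSubShift F) := by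
  refine HomologicalComplex.epi_of_epi_f _ fun k => ?_
  rw [ModuleCat.epi_iff_surjective]
  intro y
  let span {A : ModuleCat.{u} R} (a : A) : ModuleCat.of R R ⟶ A :=
    ModuleCat.ofHom (LinearMap.toSpanSingleton R A a)
  obtain ⟨x, hx⟩ : ∃ x : ∀ n, (F.obj (op n)).X k, ∀ n,
      x n - (F.map (homOfLE (n.le_add_right 1)).op).f k (x (n + 1)) =
        (Pi.π (fun n => F.obj (op n)) n).f k y :=
    (hF k).exists_sub_map_eq
      (F := F ⋙ HomologicalComplex.eval (ModuleCat.{u} R) (ComplexShape.up ℤ) k) _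
  -- elements of the product are the morphisms from the free module of rank one
  obtain ⟨z, hz⟩ := HomologicalComplex.exists_lift_piX (fun n => F.obj (op n)) k fun n => span (x n)
  have h : z ≫ (oneSubShift F).f k = span y :=
    HomologicalComplex.piX_hom_ext _ k fun n => by
      rw [Category.assoc, ← HomologicalComplex.comp_f, oneSubShift_π,
        HomologicalComplex.sub_f_apply, HomologicalComplex.comp_f, Preadditive.comp_sub,
        reassoc_of% hz, hz]
      ext
      change (1 : R) • x n - ((F.map (homOfLE _).op).f k) ((1 : R) • x (n + 1)) =
        (Pi.π (fun n => F.obj (op n)) n).f k ((1 : R) • y)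
      simpa only [one_smul] using hx n
  refine ⟨z (1 : R), ?_⟩
  have := congr($h (1 : R))
  simpa [span] using this

/-- For a Mittag-Leffler system, the sequence `0 ⟶ lim X ⟶ ∏ Xₙ ⟶ ∏ Xₙ ⟶ 0` is exact. -/
lemma shortExact (hF : IsTermwiseMittagLeffler F) {c : Cone F} (hc : IsLimit c) :
    (ShortComplex.mk _ _ c.lift_comp_oneSubShift).ShortExact where
  exact := ShortComplex.exact_of_f_is_kernel _ hc.isLimitKernelFork
  mono_f := mono_of_isLimit_fork hc.isLimitKernelFork
  epi_g := hF.epi_oneSubShift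

end IsTermwiseMittagLeffler

open DerivedCategory in
/-- The limit of a Mittag-Leffler system is the fibre of an endomorphism of the product of its
terms. -/
lemma IsColocalising.prop_Q_of_isLimit {R : Type u} [Ring R]
    [HasDerivedCategory.{w} (ModuleCat.{u} R)]
    {P : ObjectProperty (DerivedCategory (ModuleCat.{u} R))} (hP : IsColocalising.{u} P)
    {F : ℕᵒᵖ ⥤ CochainComplex (ModuleCat.{u} R) ℤ} (hF : IsTermwiseMittagLeffler F)
    (h : ∀ m, P (Q.obj (F.obj m))) {c : Cone F} (hc : IsLimit c) : P (Q.obj c.pt) := by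
  have := hP.isClosedUnderIsomorphisms
  have := hP.isTriangulated
  have hprod := hP.prop_Q_pi_nat (fun n => F.obj (op n)) fun n => h _
  exact prop_X₁_of_shortExact P (hF.shortExact hc) hprod hprod

/-! ### Stupid truncations and bounded-below complexes -/

/-- A cone over an inverse system is a limit cone if its projections are eventually isomorphisms. -/
noncomputable def CategoryTheory.Limits.isLimitOfEventuallyIsIso {D : Type*} [Category* D]
    {F : ℕᵒᵖ ⥤ D} {c : Cone F} (N : ℕ) (h : ∀ n, N ≤ n → IsIso (c.π.app (Opposite.op n))) :
    IsLimit c :=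
  have := h N le_rfl
  { lift s := s.π.app (Opposite.op N) ≫ inv (c.π.app (Opposite.op N))
    fac s j := by
      let n := max j.unop N
      let f : Opposite.op n ⟶ j := (homOfLE (le_max_left _ _)).op
      let g : Opposite.op n ⟶ Opposite.op N := (homOfLE (le_max_right _ _)).op
      have := h n (le_max_right _ _)
      have hg : IsIso (F.map g) := by
        have : IsIso (c.π.app _ ≫ F.map g) := by
          rw [c.w]
          infer_instance
        exact IsIso.of_isIso_comp_left (c.π.app _) _
      have hn : (s.π.app (Opposite.op N) ≫ inv (c.π.app (Opposite.op N))) ≫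
          c.π.app (Opposite.op n) = s.π.app (Opposite.op n) := by
        rw [← cancel_mono (F.map g), s.w, Category.assoc, c.w, Category.assoc, IsIso.inv_hom_id,
          Category.comp_id]
      rw [← c.w f, ← s.w f, ← hn]
      simp only [Category.assoc]
    uniq s m hm := by
      rw [← hm, Category.assoc, IsIso.hom_inv_id, Category.comp_id] }

namespace CochainComplex

variable {R : Type u} [Ring R] (X : CochainComplex (ModuleCat.{u} R) ℤ)

/-- The subcomplex of `X` given by the terms of degree `> n`: all of `X.X k` for `n < k`, and zero
otherwise. -/
def stupidSub (n : ℕ) (k : ℤ) : Submodule R (X.X k) := if k ≤ n then ⊥ else ⊤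

lemma stupidSub_eq_bot {n : ℕ} {k : ℤ} (h : k ≤ n) : X.stupidSub n k = ⊥ := if_pos h

lemma stupidSub_eq_top {n : ℕ} {k : ℤ} (h : n < k) : X.stupidSub n k = ⊤ := if_neg h.not_ge

lemma stupidSub_le_comap (n : ℕ) (i j : ℤ) :
    X.stupidSub n i ≤ (X.stupidSub n j).comap (X.d i j).hom := by
  by_cases hi : i ≤ n
  · rw [stupidSub_eq_bot X hi]
    exact bot_le
  · by_cases hij : (ComplexShape.up ℤ).Rel i j
    · rw [stupidSub_eq_top X (by simp at hij; lia : (n : ℤ) < j), Submodule.comap_top]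
      exact le_top
    · rw [X.shape i j hij]
      exact fun x _ => Submodule.zero_mem _

lemma stupidSub_antitone (k : ℤ) : Antitone fun n => X.stupidSub n k := fun m n h => by
  by_cases hk : k ≤ n
  · simp [stupidSub_eq_bot X hk]
  · simp [stupidSub_eq_top X (by lia : (m : ℤ) < k)]

/-- The stupid truncation of `X`, with terms `X.X k` for `k ≤ n` and zero otherwise. It is realised
as a quotient of `X` in every degree, which gives uniform formulas for the differentials. -/
def stupidQuotient (n : ℕ) : CochainComplex (ModuleCat.{u} R) ℤ where
  X k := ModuleCat.of R (X.X k ⧸ X.stupidSub n k)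
  d i j := ModuleCat.ofHom (Submodule.mapQ _ _ (X.d i j).hom (X.stupidSub_le_comap n i j))
  shape i j hij := by
    ext x
    simp [X.shape i j hij]
  d_comp_d' i j k _ _ := by
    ext x
    have : (X.d j k).hom ((X.d i j).hom x) = 0 := congr(($(X.d_comp_d i j k)).hom x)
    simp [this]

/-- The inverse system of the stupid truncations of a complex. -/
def stupidSystem : ℕᵒᵖ ⥤ CochainComplex (ModuleCat.{u} R) ℤ where
  obj n := X.stupidQuotient n.unop
  map f :=
    { f k := ModuleCat.ofHom (Submodule.factor (X.stupidSub_antitone k (leOfHom f.unop)))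
      comm' i j _ := by
        ext x
        obtain ⟨x, rfl⟩ := Submodule.mkQ_surjective _ x
        rfl }
  map_id n := by
    ext k x
    obtain ⟨x, rfl⟩ := Submodule.mkQ_surjective _ x
    rfl
  map_comp f g := by
    ext k x
    obtain ⟨x, rfl⟩ := Submodule.mkQ_surjective _ x
    rfl

/-- A complex with its projections onto its stupid truncations. -/
def stupidCone : Cone X.stupidSystem where
  pt := X
  π :=
    { app n := { f k := ModuleCat.ofHom (Submodule.mkQ _) }
      naturality m n f := by
        ext k x
        rfl }

lemma isIso_stupidCone_π_f {n : ℕ} {k : ℤ} (h : k ≤ n) :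
    IsIso ((X.stupidCone.π.app (op n)).f k) := by
  rw [ConcreteCategory.isIso_iff_bijective]
  refine ⟨?_, Submodule.mkQ_surjective _⟩
  change Function.Injective (X.stupidSub n k).mkQ
  rw [← LinearMap.ker_eq_bot, Submodule.ker_mkQ, stupidSub_eq_bot X h]

/-- Any complex is the limit of its stupid truncations, which are constant in a given degree `k`
from `n = k` on. -/
noncomputable def isLimitStupidCone : IsLimit X.stupidCone :=
  HomologicalComplex.isLimitOfEval _ _ fun k => isLimitOfEventuallyIsIso k.toNat fun n h =>
    X.isIso_stupidCone_π_f (by lia : k ≤ n)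

lemma isTermwiseMittagLeffler_stupidSystem : IsTermwiseMittagLeffler X.stupidSystem := fun k =>
  Functor.isMittagLeffler_of_surjective _ fun _ _ f =>
    Submodule.factor_surjective (X.stupidSub_antitone k (leOfHom f.unop))

end CochainComplex

open DerivedCategory in
lemma IsColocalising.prop_Q_of_isStrictlyGE {R : Type u} [Ring R]
    [HasDerivedCategory.{w} (ModuleCat.{u} R)]
    {P : ObjectProperty (DerivedCategory (ModuleCat.{u} R))} (hP : IsColocalising.{u} P)
    (X : CochainComplex (ModuleCat.{u} R) ℤ) (a : ℤ) [X.IsStrictlyGE a]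
    (h : ∀ k, P ((singleFunctor (ModuleCat.{u} R) 0).obj (X.X k))) : P (Q.obj X) := by
  have := hP.isClosedUnderIsomorphisms
  have := hP.isTriangulated
  have hzero (n : ℕ) (k : ℤ) (hk : n < k) : IsZero ((X.stupidQuotient n).X k) := by
    have : Subsingleton (X.X k ⧸ X.stupidSub n k) :=
      Submodule.Quotient.subsingleton_iff.2 (X.stupidSub_eq_top hk)
    exact ModuleCat.isZero_of_subsingleton (ModuleCat.of R (X.X k ⧸ X.stupidSub n k))
  refine hP.prop_Q_of_isLimit X.isTermwiseMittagLeffler_stupidSystem (fun m => ?_)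
    X.isLimitStupidCone
  obtain ⟨n⟩ := m
  have e {k : ℤ} (hk : k ≤ n) : X.X k ≅ (X.stupidQuotient n).X k :=
    @asIso _ _ _ _ _ (X.isIso_stupidCone_π_f hk)
  refine prop_Q_of_bounded P (n + 1 - a).toNat a (X.stupidQuotient n) (fun k hk => ?_)
    (fun k hk => hzero n k (by lia)) fun k => ?_
  · by_cases hkn : k ≤ n
    · exact (X.isZero_of_isStrictlyGE a k hk).of_iso (e hkn).symm
    · exact hzero n k (by lia)
  · by_cases hkn : k ≤ n
    · exact P.prop_of_iso ((singleFunctor (ModuleCat.{u} R) 0).mapIso (e hkn)) (h k)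
    · exact P.prop_of_isZero (Functor.map_isZero _ (hzero n k (by lia)))

end

theorem mainTheorem8 (𝕜 : Type v) [Field 𝕜] (A : Type u) [Ring A] [Algebra 𝕜 A]
    [FiniteDimensional 𝕜 A]
    -- right `A`-modules are left `Aᵐᵒᵖ`-modules
    [HasDerivedCategory.{w} (ModuleCat.{u} Aᵐᵒᵖ)]
    (C : ObjectProperty (DerivedCategory (ModuleCat.{u} Aᵐᵒᵖ)))
    (hC : IsColocalising.{u} C) :
    -- two out of three in short exact sequences of complexes
    (∀ S : ShortComplex (CochainComplex (ModuleCat.{u} Aᵐᵒᵖ) ℤ), S.ShortExact →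
      (C (DerivedCategory.Q.obj S.X₁) → C (DerivedCategory.Q.obj S.X₂) →
        C (DerivedCategory.Q.obj S.X₃)) ∧
      (C (DerivedCategory.Q.obj S.X₁) → C (DerivedCategory.Q.obj S.X₃) →
        C (DerivedCategory.Q.obj S.X₂)) ∧
      (C (DerivedCategory.Q.obj S.X₂) → C (DerivedCategory.Q.obj S.X₃) →
        C (DerivedCategory.Q.obj S.X₁))) ∧
    -- shifts
    (∀ (X : CochainComplex (ModuleCat.{u} Aᵐᵒᵖ) ℤ) (r : ℤ),
      C (DerivedCategory.Q.obj X) → C (DerivedCategory.Q.obj (X⟦r⟧))) ∧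
    -- quasi-isomorphic complexes
    (∀ X Y : CochainComplex (ModuleCat.{u} Aᵐᵒᵖ) ℤ, QuasiIsomorphic X Y →
      C (DerivedCategory.Q.obj X) → C (DerivedCategory.Q.obj Y)) ∧
    -- set-indexed (termwise) products of complexes
    (∀ (J : Type u) (X : J → CochainComplex (ModuleCat.{u} Aᵐᵒᵖ) ℤ),
      (∀ j, C (DerivedCategory.Q.obj (X j))) → C (DerivedCategory.Q.obj (∏ᶜ X))) ∧
    -- direct factors
    (∀ X Y : CochainComplex (ModuleCat.{u} Aᵐᵒᵖ) ℤ, C (DerivedCategory.Q.obj (X ⨯ Y)) →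
      C (DerivedCategory.Q.obj X) ∧ C (DerivedCategory.Q.obj Y)) ∧
    -- bounded complexes of members
    (∀ X : CochainComplex (ModuleCat.{u} Aᵐᵒᵖ) ℤ,
      (∃ a b : ℤ, X.IsStrictlyGE a ∧ X.IsStrictlyLE b) →
      (∀ k : ℤ, C ((DerivedCategory.singleFunctor (ModuleCat.{u} Aᵐᵒᵖ) 0).obj (X.X k))) →
      C (DerivedCategory.Q.obj X)) ∧
    -- inverse limits of Mittag-Leffler systems
    (∀ F : ℕᵒᵖ ⥤ CochainComplex (ModuleCat.{u} Aᵐᵒᵖ) ℤ, IsTermwiseMittagLeffler F →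
      (∀ m, C (DerivedCategory.Q.obj (F.obj m))) → C (DerivedCategory.Q.obj (limit F))) ∧
    -- bounded-below complexes of members
    (∀ X : CochainComplex (ModuleCat.{u} Aᵐᵒᵖ) ℤ, (∃ a : ℤ, X.IsStrictlyGE a) →
      (∀ k : ℤ, C ((DerivedCategory.singleFunctor (ModuleCat.{u} Aᵐᵒᵖ) 0).obj (X.X k))) →
      C (DerivedCategory.Q.obj X)) := by
  have := hC.isClosedUnderIsomorphisms
  have := hC.isTriangulated
  refine ⟨fun S hS => ⟨DerivedCategory.prop_X₃_of_shortExact C hS,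
      DerivedCategory.prop_X₂_of_shortExact C hS, DerivedCategory.prop_X₁_of_shortExact C hS⟩,
    fun X r h => DerivedCategory.prop_Q_shift h r,
    fun X Y h => (DerivedCategory.prop_Q_iff_of_quasiIsomorphic h).1,
    fun J X h => hC.prop_Q_pi X h, fun X Y h => ⟨hC.prop_Q_fst h, hC.prop_Q_snd h⟩, ?_,
    fun F hF h => hC.prop_Q_of_isLimit hF (fun m => h m) (limit.isLimit F), ?_⟩
  · rintro X ⟨a, b, _, _⟩ h
    exact DerivedCategory.prop_Q_of_bounded C (b + 1 - a).toNat a X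
      (fun k hk => X.isZero_of_isStrictlyGE a k hk)
      (fun k hk => X.isZero_of_isStrictlyLE b k (by lia)) h
  · rintro X ⟨a, _⟩ h
    exact hC.prop_Q_of_isStrictlyGE X a h
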